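/- Let $\mathcal{Z}(z) = -\zeta(z)/z$, where $\zeta$ is the Riemann zeta function. A function $f$ is called co-positive definite in a set $T \subset \mathbb{C}$ if $\sum_{k,l=1}^n f(z_k + \overline{z_l})\,\xi_k\overline{\xi_l} \ge 0$ (that is, the sum is real and non-negative) for every $n$, all $z_1,\dots,z_n \in \mathbb{C}$ with $z_k + \overline{z_l} \in T$ for all $k,l$, and all $\xi_1,\dots,\xi_n \in \mathbb{C}$; it is called co-negative definite in $T$ if $-f$ is co-positive definite in $T$. A cosum set is a set of the form $\{z_1 + \overline{z_2} : z_1, z_2 \in \Omega\}$ with $\Omega \subset \mathbb{C}$. A non-negative measure $\mu$ on $\mathbb{R}$ is exponentially finite with respect to an interval $I$ if $\int_{-\infty}^{+\infty} e^{-yt}\,d\mu(t) < \infty$ for every $y \in I$. Let $H(t)$ be the number of integers $n \ge 1$ with $\ln n \le t$, and let $\{x\}$ denote the fractional part of $x$. Then: 1. On the strip $0 < \operatorname{Re} z < 1$, $\mathcal{Z}$ is holomorphic and co-positive definite, and $\mathcal{Z}(z) = \int_{-\infty}^{+\infty} \{e^t\}\, e^{-zt}\,dt$ with an absolutely convergent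 integral. Here $\{e^t\} = e^t - H(t)$ for every real $t$, and the measure $\{e^t\}\,dt$ is exponentially finite with respect to $(0,1)$. 2. On the half-plane $\operatorname{Re} z > 1$, $\mathcal{Z}$ is holomorphic and co-negative definite, and $\mathcal{Z}(z) = \int_{-\infty}^{+\infty} (-H(t))\, e^{-zt}\,dt$ with an absolutely convergent integral. The measure $H(t)\,dt$ is exponentially finite with respect to $(1,+\infty)$. 3. $\mathcal{Z}$ is neither co-positive definite nor co-negative definite in any non-empty open cosum set contained in the half-plane $\operatorname{Re} z < 0$. -/

import Mathlib

open scoped ComplexConjugate ComplexOrder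

/-- The vertical strip `a < Re z < b`, with extended real endpoints. -/
def verticalStrip (a b : EReal) : Set ℂ :=
  {z : ℂ | a < (z.re : EReal) ∧ (z.re : EReal) < b}

/-- The set of all `z₁ + conj z₂` with `z₁` and `z₂` in `Ω`. -/
def cosum (Ω : Set ℂ) : Set ℂ :=
  {z : ℂ | ∃ z₁ ∈ Ω, ∃ z₂ ∈ Ω, z = z₁ + conj z₂}

/-- A set is a cosum set if it is the cosum of some set. -/
def IsCosumSet (T : Set ℂ) : Prop :=
  ∃ Ω : Set ℂ, T = cosum Ω

/-- Co-positive definiteness of `f` in `T`. The inequality `0 ≤ w` for a complex number `w`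
says that `w` is real and non-negative. -/
def IsCoPositiveDefiniteOn (f : ℂ → ℂ) (T : Set ℂ) : Prop :=
  ∀ (n : ℕ) (z : Fin n → ℂ), (∀ k l, z k + conj (z l) ∈ T) →
    ∀ ξ : Fin n → ℂ, 0 ≤ ∑ k, ∑ l, f (z k + conj (z l)) * ξ k * conj (ξ l)

/-- `f` is co-negative definite in `T` if `-f` is co-positive definite in `T`. -/
def IsCoNegativeDefiniteOn (f : ℂ → ℂ) (T : Set ℂ) : Prop :=
  IsCoPositiveDefiniteOn (fun z => -f z) T

/-- A (non-negative) measure on the real line is exponentially finite with respect to `I` if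
the integral of `exp (-y t)` is finite for every `y` in `I`. -/
def IsExponentiallyFinite (μ : MeasureTheory.Measure ℝ) (I : Set ℝ) : Prop :=
  ∀ y ∈ I, ∫⁻ t, ENNReal.ofReal (Real.exp (-y * t)) ∂μ < ⊤

/-- The non-negative measure with density `σ` with respect to Lebesgue measure
(used for non-negative `σ`). -/
noncomputable def densityMeasure (σ : ℝ → ℝ) : MeasureTheory.Measure ℝ :=
  MeasureTheory.volume.withDensity (fun t => ENNReal.ofReal (σ t))

/-- On `T`, the function `f` is the absolutely convergent integral of `σ t * exp (-z t)` over
the real line: `σ` is a (possibly signed) density representing `f` on `T`. -/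
def HasDensityOn (f : ℂ → ℂ) (σ : ℝ → ℝ) (T : Set ℂ) : Prop :=
  ∀ z ∈ T, MeasureTheory.Integrable (fun t : ℝ => (σ t : ℂ) * Complex.exp (-z * t)) ∧
    f z = ∫ t : ℝ, (σ t : ℂ) * Complex.exp (-z * t)

/-- The function `-ζ(z)/z`. -/
noncomputable def zedFunction (z : ℂ) : ℂ := -riemannZeta z / z

/-- The number of integers `n ≥ 1` with `log n ≤ t` (a finite set for every `t`). -/
noncomputable def logCount (t : ℝ) : ℕ :=
  {n : ℕ | 1 ≤ n ∧ Real.log n ≤ t}.ncard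

open Set MeasureTheory Filter Topology Asymptotics

/-! The substitution `u = exp t` turns the integrals of parts 1 and 2 into Mellin transforms at `-z`
of the fractional part and of the floor function. Abel summation gives `ζ(z)/z` for the floor when
`Re z > 1` (`mellin_floor`). Both functions differ from `± fractTail`, whose transform is
holomorphic on `Re z > 0`, only by the identity on `(0, 1]` or on `(1, ∞)`. These contribute `1/(1 -
z)` and `1/(z - 1)`, so continuing through `riemannZeta₀` gives the formula on the strip
(`mellin_fract_eq_zedFunction`). A non-negative density makes the quadratic form the integral of a
squared modulus, which yields definiteness.

For part 3, definiteness spreads by real translation: `(1 + c d/dz)^2` preserves it, and `(1 + (h/n)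
d/dz)^n f` tends to `f(· + h)` within a disc of holomorphy (`IsCoPositiveDefiniteOn.comp_add_real`).
An open cosum set contains a real point, so definiteness in the left half-plane would fix the sign
of the function on the whole negative axis. But its values at `-1` and `-3` are `-1/12` and `1/360`.
-/

/-! ### Mellin transforms as two-sided Laplace transforms. -/

theorem exp_smul_cpow_sub_one_smul (t : ℝ) (z w : ℂ) :
    Real.exp t • (((Real.exp t : ℝ) : ℂ) ^ (-z - 1) • w) = w * Complex.exp (-z * t) := by
  rw [Complex.real_smul, smul_eq_mul, ← mul_assoc, Complex.ofReal_exp,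
    Complex.cpow_def_of_ne_zero (Complex.exp_ne_zero _), ← Complex.ofReal_exp, ← Complex.ofReal_log
    (Real.exp_pos t).le, Real.log_exp, Complex.ofReal_exp, ← Complex.exp_add, mul_comm]
  ring_nf

/-- The Mellin transform becomes a two-sided Laplace transform under `u = exp t`. -/
theorem mellinConvergent_neg_iff_integrable_exp (g : ℝ → ℝ) (z : ℂ) :
    MellinConvergent (fun t => (g t : ℂ)) (-z) ↔
      Integrable (fun t : ℝ => (g (Real.exp t) : ℂ) * Complex.exp (-z * t)) := by
  rw [MellinConvergent, ← Real.range_exp, ← image_univ,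
    integrableOn_image_iff_integrableOn_abs_deriv_smul MeasurableSet.univ
      (fun x _ => (Real.hasDerivAt_exp x).hasDerivWithinAt) Real.exp_injective.injOn,
    integrableOn_univ]
  refine iff_of_eq (congrArg (Integrable · volume) ?_)
  ext t
  rw [abs_of_pos (Real.exp_pos t), exp_smul_cpow_sub_one_smul]

theorem mellin_neg_eq_integral_exp (g : ℝ → ℝ) (z : ℂ) :
    mellin (fun t => (g t : ℂ)) (-z) =
      ∫ t : ℝ, (g (Real.exp t) : ℂ) * Complex.exp (-z * t) := by
  rw [mellin, ← Real.range_exp, ← image_univ,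
    integral_image_eq_integral_abs_deriv_smul MeasurableSet.univ
      (fun x _ => (Real.hasDerivAt_exp x).hasDerivWithinAt) Real.exp_injective.injOn,
    setIntegral_univ]
  refine integral_congr_ae (ae_of_all _ fun t => ?_)
  dsimp only
  rw [abs_of_pos (Real.exp_pos t), exp_smul_cpow_sub_one_smul]

/-! ### Mellin transforms of the fractional part and the floor, and their link to zeta. -/

/-- The fractional part with the identity function on `(0, 1]` removed. -/
noncomputable def fractTail (t : ℝ) : ℝ := Int.fract t - (Ioc (0 : ℝ) 1).indicator id t

theorem measurable_fractTail : Measurable fractTail :=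
  measurable_fract.sub (measurable_id.indicator measurableSet_Ioc)

theorem abs_fract_le_one (t : ℝ) : |Int.fract t| ≤ 1 := by
  rw [abs_of_nonneg (Int.fract_nonneg t)]
  exact (Int.fract_lt_one t).le

theorem abs_fractTail_le_one (t : ℝ) : |fractTail t| ≤ 1 := by
  have h0 := Int.fract_nonneg t
  have h1 := (Int.fract_lt_one t).le
  unfold fractTail indicator
  split_ifs with h
  · obtain ⟨h2, h3⟩ := h
    rw [abs_le]
    constructor <;> simp only [id] <;> linarith
  · rw [sub_zero]
    exact abs_fract_le_one t

theorem fractTail_of_mem_Ioo {t : ℝ} (ht : t ∈ Ioo (0 : ℝ) 1) : fractTail t = 0 := by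
  rw [fractTail, indicator_of_mem (Ioo_subset_Ioc_self ht),
    Int.fract_eq_self.mpr ⟨ht.1.le, ht.2⟩, id, sub_self]

theorem locallyIntegrableOn_of_abs_le_one {g : ℝ → ℝ} (hg : Measurable g)
    (h : ∀ t, |g t| ≤ 1) (s : Set ℝ) : LocallyIntegrableOn (fun t => (g t : ℂ)) s := by
  refine LocallyIntegrable.locallyIntegrableOn ?_ s
  refine (locallyIntegrable_const (1 : ℝ)).mono
    (Complex.measurable_ofReal.comp hg).aestronglyMeasurable (ae_of_all _ fun t => ?_)
  simpa using h t

theorem isBigO_atTop_of_abs_le_one {g : ℝ → ℝ} (h : ∀ t, |g t| ≤ 1) :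
    (fun t => (g t : ℂ)) =O[atTop] fun t : ℝ => t ^ (-(0 : ℝ)) :=
  IsBigO.of_bound 1 (Eventually.of_forall fun t => by simpa using h t)

/-- Since `fractTail` vanishes on `(0, 1)`, every exponent `b` is allowed; hence its transform has
no left-hand boundary of convergence and only `0 < z.re` is needed. -/
theorem isBigO_fractTail_zero (b : ℝ) :
    (fun t => (fractTail t : ℂ)) =O[𝓝[>] 0] fun t : ℝ => t ^ (-b) := by
  refine IsBigO.of_bound 1 ?_
  filter_upwards [Ioo_mem_nhdsGT (zero_lt_one' ℝ)] with t ht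
  rw [fractTail_of_mem_Ioo ht]
  simp

theorem isBigO_fract_zero :
    (fun t => ((Int.fract t : ℝ) : ℂ)) =O[𝓝[>] 0] fun t : ℝ => t ^ (-(-1 : ℝ)) := by
  refine IsBigO.of_bound 1 ?_
  filter_upwards [Ioo_mem_nhdsGT (zero_lt_one' ℝ)] with t ht
  rw [Int.fract_eq_self.mpr ⟨ht.1.le, ht.2⟩]
  simp

theorem mellinConvergent_fractTail {z : ℂ} (hz : 0 < z.re) :
    MellinConvergent (fun t => (fractTail t : ℂ)) (-z) :=
  mellinConvergent_of_isBigO_rpow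
    (locallyIntegrableOn_of_abs_le_one measurable_fractTail abs_fractTail_le_one _)
    (isBigO_atTop_of_abs_le_one abs_fractTail_le_one) (by simpa using hz)
    (isBigO_fractTail_zero ((-z).re - 1)) (by linarith)

theorem differentiableAt_mellin_fractTail {z : ℂ} (hz : 0 < z.re) :
    DifferentiableAt ℂ (mellin fun t => (fractTail t : ℂ)) (-z) :=
  mellin_differentiableAt_of_isBigO_rpow
    (locallyIntegrableOn_of_abs_le_one measurable_fractTail abs_fractTail_le_one _)
    (isBigO_atTop_of_abs_le_one abs_fractTail_le_one) (by simpa using hz)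
    (isBigO_fractTail_zero ((-z).re - 1)) (by linarith)

theorem mellinConvergent_fract {z : ℂ} (h0 : 0 < z.re) (h1 : z.re < 1) :
    MellinConvergent (fun t => ((Int.fract t : ℝ) : ℂ)) (-z) :=
  mellinConvergent_of_isBigO_rpow
    (locallyIntegrableOn_of_abs_le_one measurable_fract abs_fract_le_one _)
    (isBigO_atTop_of_abs_le_one abs_fract_le_one) (by simpa using h0)
    isBigO_fract_zero (by simpa using h1)

theorem mellin_fract {z : ℂ} (h0 : 0 < z.re) (h1 : z.re < 1) :
    mellin (fun t => ((Int.fract t : ℝ) : ℂ)) (-z) =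
      mellin (fun t => (fractTail t : ℂ)) (-z) + 1 / (1 - z) := by
  have hI := hasMellin_cpow_Ioc 1 (s := -z) (by simpa using h1)
  rw [show 1 - z = -z + 1 by ring, ← hI.2, ← (hasMellin_add (mellinConvergent_fractTail h0) hI.1).2]
  congr 1
  ext t
  rw [fractTail]
  by_cases h : t ∈ Ioc (0 : ℝ) 1
  · rw [indicator_of_mem h, indicator_of_mem h, id, Complex.ofReal_sub, Complex.cpow_one,
      sub_add_cancel]
  · simp [h]

theorem hasMellin_id_Ioi_one {z : ℂ} (hz : 1 < z.re) :
    HasMellin ((Ioi (1 : ℝ)).indicator fun t => (t : ℂ)) (-z) (1 / (z - 1)) := by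
  have hre : (-z).re < -1 := by simpa using hz
  have key : (fun t : ℝ => (t : ℂ) ^ (-z - 1) • (Ioi (1 : ℝ)).indicator (fun t => (t : ℂ)) t) =
      (Ioi (1 : ℝ)).indicator fun t : ℝ => (t : ℂ) ^ (-z) := by
    ext t
    by_cases h : t ∈ Ioi (1 : ℝ)
    · have ht : (t : ℂ) ≠ 0 := by exact_mod_cast (zero_lt_one.trans (mem_Ioi.mp h)).ne'
      rw [indicator_of_mem h, indicator_of_mem h, smul_eq_mul, Complex.cpow_sub _ _ ht,
        Complex.cpow_one, div_mul_cancel₀ _ ht]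
    · simp [h]
  have hsub : Ioi (1 : ℝ) ⊆ Ioi 0 := Ioi_subset_Ioi zero_le_one
  constructor
  · rw [MellinConvergent, key, IntegrableOn, integrable_indicator_iff measurableSet_Ioi,
      IntegrableOn, Measure.restrict_restrict measurableSet_Ioi, inter_eq_left.mpr hsub]
    exact integrableOn_Ioi_cpow_of_lt hre zero_lt_one
  · rw [mellin, key, setIntegral_indicator measurableSet_Ioi, inter_eq_right.mpr hsub,
      integral_Ioi_cpow_of_lt hre zero_lt_one]
    simp only [Complex.ofReal_one, Complex.one_cpow]
    rw [show z - 1 = -(-z + 1) by ring, div_neg, neg_div]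

theorem floor_eq_sub_fractTail {t : ℝ} (ht : 0 < t) :
    ((⌊t⌋₊ : ℝ) : ℂ) = (Ioi (1 : ℝ)).indicator (fun t => (t : ℂ)) t - (fractTail t : ℂ) := by
  have h : (⌊t⌋₊ : ℝ) = t - Int.fract t := by
    rw [natCast_floor_eq_intCast_floor ht.le, Int.self_sub_fract]
  rw [h, fractTail]
  by_cases h1 : t ≤ 1
  · simp [h1, ht]
  · simp [h1, not_le.mp h1, -Int.self_sub_fract]

theorem hasMellin_floor_of_fractTail {z : ℂ} (hz : 1 < z.re) :
    HasMellin (fun t => ((⌊t⌋₊ : ℝ) : ℂ)) (-z)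
      (1 / (z - 1) - mellin (fun t => (fractTail t : ℂ)) (-z)) := by
  have hI := hasMellin_id_Ioi_one hz
  have h := hasMellin_sub hI.1 (mellinConvergent_fractTail (zero_lt_one.trans hz))
  rw [hI.2] at h
  constructor
  · refine (integrableOn_congr_fun (fun t ht => ?_) measurableSet_Ioi).mpr h.1
    simp only [floor_eq_sub_fractTail ht]
  · rw [← h.2]
    refine setIntegral_congr_fun measurableSet_Ioi fun t ht => ?_
    simp only [floor_eq_sub_fractTail ht]

/-- Abel summation for the Dirichlet series with all coefficients `1`, whose partial sums are the
floor function. -/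
theorem mellin_floor {z : ℂ} (hz : 1 < z.re) :
    mellin (fun t => ((⌊t⌋₊ : ℝ) : ℂ)) (-z) = riemannZeta z / z := by
  have hz0 : z ≠ 0 := by
    rintro rfl
    norm_num at hz
  have hL := LSeries_eq_mul_integral_of_nonneg (fun _ => 1) (r := 1) zero_le_one hz
    (IsBigO.of_bound 1 (Eventually.of_forall fun n => by simp)) fun _ => zero_le_one
  have hone : LSeries (fun _ => ((1 : ℝ) : ℂ)) z = riemannZeta z := by
    rw [← LSeries_one_eq_riemannZeta hz]
    congr 1
  rw [hone] at hL
  rw [hL, mul_div_cancel_left₀ _ hz0, mellin]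
  -- The floor vanishes on `(0, 1)` but not at `1`, so the domain shrinks to `(1, ∞)` only up to a
  -- null set.
  have hae : ∀ᵐ t : ℝ, t ≠ 1 := by simp [ae_iff, measure_singleton]
  rw [setIntegral_eq_of_subset_of_ae_sdiff_eq_zero (s := Ioi (1 : ℝ))
    measurableSet_Ioi.nullMeasurableSet (Ioi_subset_Ioi zero_le_one)]
  · refine setIntegral_congr_fun measurableSet_Ioi fun t _ => ?_
    simp only [smul_eq_mul, Complex.ofReal_one, Finset.sum_const, Nat.card_Icc, Nat.add_sub_cancel,
      nsmul_eq_mul, mul_one, Complex.ofReal_natCast]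
    rw [mul_comm, neg_add']
  · filter_upwards [hae] with t ht1 ht
    have hlt : t < 1 := lt_of_le_of_ne (by simpa using ht.2) ht1
    simp [Nat.floor_eq_zero.mpr hlt]

/-- Comparing the two evaluations of the floor's transform proves this near `2`; both sides are
holomorphic on `Re z > 0`, so the identity theorem extends it. -/
theorem riemannZeta₀_eq_one_sub_mul_mellin {z : ℂ} (hz : 0 < z.re) :
    riemannZeta₀ z = 1 - z * mellin (fun t => (fractTail t : ℂ)) (-z) := by
  have hopen : IsOpen {z : ℂ | 0 < z.re} := isOpen_lt continuous_const Complex.continuous_re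
  have hconn : IsPreconnected {z : ℂ | 0 < z.re} := (convex_halfSpace_re_gt 0).isPreconnected
  have hd : DifferentiableOn ℂ (fun z => 1 - z * mellin (fun t => (fractTail t : ℂ)) (-z))
      {z : ℂ | 0 < z.re} := fun w hw =>
    ((differentiableAt_const _).sub (differentiableAt_id.mul
      ((differentiableAt_mellin_fractTail hw).comp w
        differentiableAt_id.neg))).differentiableWithinAt
  refine (differentiable_riemannZeta₀.differentiableOn.analyticOnNhd
    hopen).eqOn_of_preconnected_of_eventuallyEq (hd.analyticOnNhd hopen) hconn
    (z₀ := 2) (by simp) ?_ hz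
  have hev : ∀ᶠ w : ℂ in 𝓝 2, 1 < w.re :=
    (isOpen_lt continuous_const Complex.continuous_re).mem_nhds (by simp)
  filter_upwards [hev] with w hw
  have h1 : w - 1 ≠ 0 := by
    intro h
    rw [sub_eq_zero.mp h] at hw
    simp at hw
  have h0 : w ≠ 0 := by
    rintro rfl
    norm_num at hw
  have h := (hasMellin_floor_of_fractTail hw).2
  rw [mellin_floor hw, riemannZeta_eq_inv_sub_add (sub_ne_zero.mp h1)] at h
  field_simp at h
  refine mul_left_cancel₀ h1 ?_
  linear_combination h

theorem mellin_fract_eq_zedFunction {z : ℂ} (h0 : 0 < z.re) (h1 : z.re < 1) :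
    mellin (fun t => ((Int.fract t : ℝ) : ℂ)) (-z) = zedFunction z := by
  have hz0 : z ≠ 0 := by
    rintro rfl
    norm_num at h0
  have hz1 : z ≠ 1 := by
    rintro rfl
    norm_num at h1
  have h1z : 1 - z ≠ 0 := sub_ne_zero.mpr hz1.symm
  have hz1' : z - 1 ≠ 0 := sub_ne_zero.mpr hz1
  rw [mellin_fract h0 h1, zedFunction, riemannZeta_eq_inv_sub_add hz1,
    riemannZeta₀_eq_one_sub_mul_mellin h0, ← neg_sub z 1]
  field_simp
  ring

/-! ### Densities, co-positive definiteness and exponential finiteness. -/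

theorem logCount_eq_floor (t : ℝ) : logCount t = ⌊Real.exp t⌋₊ := by
  have h : {n : ℕ | 1 ≤ n ∧ Real.log n ≤ t} = Finset.Icc 1 ⌊Real.exp t⌋₊ := by
    ext n
    simp only [mem_ofPred_eq, Finset.coe_Icc, mem_Icc, and_congr_right_iff]
    intro hn
    rw [Nat.le_floor_iff (Real.exp_pos t).le, Real.log_le_iff_le_exp (by exact_mod_cast hn)]
  rw [logCount, h, ncard_coe_finset, Nat.card_Icc, Nat.add_sub_cancel]

theorem fract_exp_eq_sub_logCount (t : ℝ) :
    Int.fract (Real.exp t) = Real.exp t - (logCount t : ℝ) := by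
  rw [logCount_eq_floor, natCast_floor_eq_intCast_floor (Real.exp_pos t).le, Int.self_sub_floor]

theorem hasDensityOn_fract :
    HasDensityOn zedFunction (fun t => Int.fract (Real.exp t)) (verticalStrip 0 1) := by
  rintro z ⟨h0, h1⟩
  have h0' : 0 < z.re := by exact_mod_cast h0
  have h1' : z.re < 1 := by exact_mod_cast h1
  exact ⟨(mellinConvergent_neg_iff_integrable_exp _ z).mp (mellinConvergent_fract h0' h1'),
    (mellin_fract_eq_zedFunction h0' h1').symm.trans (mellin_neg_eq_integral_exp _ z)⟩

theorem hasDensityOn_logCount :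
    HasDensityOn (fun z => -zedFunction z) (fun t => (logCount t : ℝ)) (verticalStrip 1 ⊤) := by
  rintro z ⟨h1, -⟩
  have h1' : 1 < z.re := by exact_mod_cast h1
  simp only [logCount_eq_floor]
  refine ⟨(mellinConvergent_neg_iff_integrable_exp (fun t => (⌊t⌋₊ : ℝ)) z).mp
    (hasMellin_floor_of_fractTail h1').1, ?_⟩
  rw [← mellin_neg_eq_integral_exp (fun t => (⌊t⌋₊ : ℝ)) z, mellin_floor h1', zedFunction,
    neg_div, neg_neg]

theorem HasDensityOn.neg {f : ℂ → ℂ} {σ : ℝ → ℝ} {T : Set ℂ} (h : HasDensityOn f σ T) :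
    HasDensityOn (fun z => -f z) (fun t => -σ t) T := fun z hz => by
  have heq : (fun t : ℝ => ((-σ t : ℝ) : ℂ) * Complex.exp (-z * t)) =
      -fun t : ℝ => (σ t : ℂ) * Complex.exp (-z * t) := by
    ext t
    simp
  simp only [heq]
  exact ⟨(h z hz).1.neg, (congrArg Neg.neg (h z hz).2).trans (integral_neg _).symm⟩

/-- A function with a non-negative density is co-positive definite. -/
theorem HasDensityOn.isCoPositiveDefiniteOn {f : ℂ → ℂ} {σ : ℝ → ℝ} {T : Set ℂ}
    (h : HasDensityOn f σ T) (hσ : ∀ t, 0 ≤ σ t) : IsCoPositiveDefiniteOn f T := by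
  intro n z hz ξ
  have hint : ∀ k l, Integrable (fun t : ℝ =>
      (σ t : ℂ) * Complex.exp (-(z k + conj (z l)) * t) * ξ k * conj (ξ l)) := fun k l =>
    ((h _ (hz k l)).1.mul_const _).mul_const _
  have heq : ∑ k, ∑ l, f (z k + conj (z l)) * ξ k * conj (ξ l) =
      ∫ t : ℝ, ∑ k, ∑ l, (σ t : ℂ) * Complex.exp (-(z k + conj (z l)) * t) * ξ k * conj (ξ l) := by
    rw [integral_finsetSum _ fun k _ => integrable_finsetSum _ fun l _ => hint k l]
    refine Finset.sum_congr rfl fun k _ => ?_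
    rw [integral_finsetSum _ fun l _ => hint k l]
    refine Finset.sum_congr rfl fun l _ => ?_
    rw [(h _ (hz k l)).2, integral_mul_const, integral_mul_const]
  -- The exponential of `z k + conj (z l)` factors, so the double sum is the squared modulus of a
  -- single sum.
  have hsq : ∀ t : ℝ,
      ∑ k, ∑ l, (σ t : ℂ) * Complex.exp (-(z k + conj (z l)) * t) * ξ k * conj (ξ l) =
        ((σ t * ‖∑ k, Complex.exp (-z k * t) * ξ k‖ ^ 2 : ℝ) : ℂ) := by
    intro t
    push_cast
    rw [← Complex.mul_conj', map_sum, Finset.sum_mul_sum, Finset.mul_sum]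
    refine Finset.sum_congr rfl fun k _ => ?_
    rw [Finset.mul_sum]
    refine Finset.sum_congr rfl fun l _ => ?_
    rw [map_mul, ← Complex.exp_conj, map_mul, map_neg, Complex.conj_ofReal, neg_add, add_mul,
      Complex.exp_add]
    ring
  rw [heq, integral_congr_ae (ae_of_all _ hsq), integral_complex_ofReal]
  exact_mod_cast integral_nonneg fun t => mul_nonneg (hσ t) (by positivity)

theorem HasDensityOn.isExponentiallyFinite {f : ℂ → ℂ} {σ : ℝ → ℝ} {T : Set ℂ} {I : Set ℝ}
    (h : HasDensityOn f σ T) (hσ : ∀ t, 0 ≤ σ t) (hm : Measurable σ)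
    (hI : ∀ y ∈ I, (y : ℂ) ∈ T) : IsExponentiallyFinite (densityMeasure σ) I := by
  intro y hy
  have hint := (h y (hI y hy)).1.norm
  rw [densityMeasure, lintegral_withDensity_eq_lintegral_mul _ hm.ennreal_ofReal (by fun_prop)]
  convert hint.lintegral_lt_top using 3 with t
  rw [Pi.mul_apply, ← ENNReal.ofReal_mul (hσ t), norm_mul, Complex.norm_real,
    Real.norm_of_nonneg (hσ t), Complex.norm_exp]
  simp

/-- Co-positive definiteness for families over an arbitrary finite index type. -/
theorem IsCoPositiveDefiniteOn.sum_nonneg {f : ℂ → ℂ} {T : Set ℂ}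
    (h : IsCoPositiveDefiniteOn f T) {ι : Type*} [Fintype ι] (z : ι → ℂ)
    (hz : ∀ k l, z k + conj (z l) ∈ T) (ξ : ι → ℂ) :
    0 ≤ ∑ k, ∑ l, f (z k + conj (z l)) * ξ k * conj (ξ l) := by
  let e := (Fintype.equivFin ι).symm
  have := h _ (z ∘ e) (fun k l => hz _ _) (ξ ∘ e)
  simp only [Function.comp_apply] at this
  rw [← e.sum_comp]
  convert this using 2 with k
  rw [← e.sum_comp]

theorem IsCoPositiveDefiniteOn.congr {f g : ℂ → ℂ} {T : Set ℂ}
    (h : IsCoPositiveDefiniteOn f T) (hfg : EqOn f g T) : IsCoPositiveDefiniteOn g T := by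
  intro n z hz ξ
  convert h n z hz ξ using 6 with k _ l
  exact (hfg (hz k l)).symm

theorem IsCoPositiveDefiniteOn.nonneg_of_mem {f : ℂ → ℂ} {T : Set ℂ}
    (h : IsCoPositiveDefiniteOn f T) {x : ℝ} (hx : (x : ℂ) ∈ T) : 0 ≤ f x := by
  have hxx : (x : ℂ) / 2 + conj ((x : ℂ) / 2) = x := by
    rw [map_div₀, Complex.conj_ofReal, map_ofNat, add_halves]
  have := h 1 (fun _ => x / 2) (fun _ _ => by simpa only [hxx] using hx) fun _ => 1
  simpa only [Finset.univ_unique, Finset.sum_const, Finset.card_singleton, one_smul, hxx,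
    map_one, mul_one] using this

/-! ### Difference quotients and the operator `1 + c d/dz`. -/

theorem isLittleO_taylor_two {f : ℂ → ℂ} {w : ℂ} (hf : AnalyticAt ℂ f w) :
    (fun y => f (w + y) - (f w + deriv f w * y + deriv (deriv f) w / 2 * y ^ 2)) =o[𝓝 0]
      fun y => y ^ 2 := by
  have h := hf.hasFPowerSeriesAt.isBigO_sub_partialSum_pow 3
  have h' : (fun y : ℂ => ‖y‖ ^ 3) =o[𝓝 0] fun y => y ^ 2 := by
    simp_rw [← norm_pow]
    exact (isLittleO_pow_pow (by norm_num : 2 < 3)).norm_left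
  refine (h.trans_isLittleO h').congr_left fun y => ?_
  simp [FormalMultilinearSeries.partialSum, Finset.sum_range_succ, iteratedDeriv_succ]
  ring

theorem tendsto_first_difference {f : ℂ → ℂ} {w : ℂ} (hf : DifferentiableAt ℂ f w) :
    Tendsto (fun ε : ℝ => (f (w + ε) - f w) / ε) (𝓝[>] 0) (𝓝 (deriv f w)) := by
  have h := hf.hasDerivAt.tendsto_slope_zero
  have hc : Tendsto (fun ε : ℝ => (ε : ℂ)) (𝓝[>] 0) (𝓝[≠] 0) := by
    refine tendsto_nhdsWithin_iff.mpr ⟨?_, ?_⟩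
    · exact (Complex.continuous_ofReal.tendsto' 0 0 Complex.ofReal_zero).mono_left
        nhdsWithin_le_nhds
    · filter_upwards [self_mem_nhdsWithin] with ε hε
      simpa using (mem_Ioi.mp hε).ne'
  refine (h.comp hc).congr fun ε => ?_
  simp [div_eq_inv_mul]

theorem tendsto_second_difference {f : ℂ → ℂ} {w : ℂ} (hf : AnalyticAt ℂ f w) :
    Tendsto (fun ε : ℝ => (f (w + 2 * ε) - 2 * f (w + ε) + f w) / ε ^ 2) (𝓝[>] 0)
      (𝓝 (deriv (deriv f) w)) := by
  set R : ℂ → ℂ := fun y =>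
    f (w + y) - (f w + deriv f w * y + deriv (deriv f) w / 2 * y ^ 2) with hR
  have hRo : R =o[𝓝 0] fun y => y ^ 2 := isLittleO_taylor_two hf
  have hlim : ∀ a : ℂ, a ≠ 0 →
      Tendsto (fun ε : ℝ => R (a * ε) / (ε : ℂ) ^ 2) (𝓝[>] 0) (𝓝 0) := by
    intro a ha
    have hc : Tendsto (fun ε : ℝ => a * (ε : ℂ)) (𝓝[>] 0) (𝓝 0) :=
      ((continuous_const.mul Complex.continuous_ofReal).tendsto' 0 0 (by simp)).mono_left
        nhdsWithin_le_nhds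
    have h := (hRo.tendsto_div_nhds_zero.comp hc).const_mul (a ^ 2)
    rw [mul_zero] at h
    refine h.congr fun ε => ?_
    simp only [Function.comp_apply]
    field_simp
  -- The second difference quotient is exactly `f''(w) + R(2ε)/ε² - 2R(ε)/ε²`.
  have h := ((hlim 2 two_ne_zero).sub ((hlim 1 one_ne_zero).const_mul 2)).const_add
    (deriv (deriv f) w)
  simp only [mul_zero, sub_zero, add_zero] at h
  refine h.congr' ?_
  filter_upwards [self_mem_nhdsWithin] with ε hε
  have hε' : (ε : ℂ) ≠ 0 := by simpa using (mem_Ioi.mp hε).ne'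
  simp only [hR, one_mul]
  field_simp
  ring

/-- The square of the operator `1 + c d/dz` preserves co-positive definiteness for real `c`. -/
theorem IsCoPositiveDefiniteOn.add_deriv_add_deriv_deriv {f : ℂ → ℂ} {T : Set ℂ}
    (h : IsCoPositiveDefiniteOn f T) (hT : IsOpen T) (hf : DifferentiableOn ℂ f T) (c : ℝ) :
    IsCoPositiveDefiniteOn (fun w => f w + 2 * c * deriv f w + c ^ 2 * deriv (deriv f) w) T := by
  intro n z hz ξ
  have hlim : ∀ k l, Tendsto (fun ε : ℝ =>
      (f (z k + conj (z l)) +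
          2 * c * ((f (z k + conj (z l) + ε) - f (z k + conj (z l))) / ε) +
          c ^ 2 * ((f (z k + conj (z l) + 2 * ε) - 2 * f (z k + conj (z l) + ε) +
            f (z k + conj (z l))) / ε ^ 2)) * ξ k * conj (ξ l)) (𝓝[>] 0)
      (𝓝 ((f (z k + conj (z l)) + 2 * c * deriv f (z k + conj (z l)) +
        c ^ 2 * deriv (deriv f) (z k + conj (z l))) * ξ k * conj (ξ l))) := by
    intro k l
    have ha : AnalyticAt ℂ f (z k + conj (z l)) := hf.analyticAt (hT.mem_nhds (hz k l))
    exact (((tendsto_const_nhds.add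
      ((tendsto_first_difference ha.differentiableAt).const_mul _)).add
      ((tendsto_second_difference ha).const_mul _)).mul_const _).mul_const _
  refine ge_of_tendsto (tendsto_finsetSum _ fun k _ => tendsto_finsetSum _ fun l _ => hlim k l) ?_
  have hnear : ∀ a : ℝ, ∀ᶠ ε : ℝ in 𝓝[>] 0, ∀ k l, z k + conj (z l) + a * ε ∈ T := by
    intro a
    refine eventually_all.mpr fun k => eventually_all.mpr fun l => ?_
    have hc : Tendsto (fun ε : ℝ => z k + conj (z l) + a * ε) (𝓝[>] 0) (𝓝 (z k + conj (z l))) :=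
      ((continuous_const.add (continuous_const.mul Complex.continuous_ofReal)).tendsto' 0 _
        (by simp)).mono_left nhdsWithin_le_nhds
    exact hc.eventually (hT.mem_nhds (hz k l))
  filter_upwards [hnear 1, hnear 2, self_mem_nhdsWithin] with ε h1 h2 hε
  have hε' : (ε : ℂ) ≠ 0 := by simpa using (mem_Ioi.mp hε).ne'
  -- Each point is doubled to `z k`, `z k + ε` with weights `1 - c/ε`, `c/ε`: the discrete version
  -- of `1 + c d/dz`. It acts once in each index, which is why its square appears.
  have hpos := h.sum_nonneg (Sum.elim z fun k => z k + ε) ?_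
    (Sum.elim (fun k => ((1 - c / ε : ℝ) : ℂ) * ξ k) fun k => ((c / ε : ℝ) : ℂ) * ξ k)
  · simp only [Fintype.sum_sum_type, Sum.elim_inl, Sum.elim_inr, ← Finset.sum_add_distrib] at hpos
    refine hpos.trans_eq (Finset.sum_congr rfl fun k _ => Finset.sum_congr rfl fun l _ => ?_)
    simp only [map_add, map_mul, Complex.conj_ofReal]
    rw [show z k + (conj (z l) + ε) = z k + conj (z l) + ε by ring,
      show z k + ε + conj (z l) = z k + conj (z l) + ε by ring,
      show z k + ε + (conj (z l) + ε) = z k + conj (z l) + 2 * ε by ring]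
    push_cast
    field_simp
    ring
  · rintro (k | k) (l | l)
    · exact hz k l
    · convert h1 k l using 1
      simp
      ring
    · convert h1 k l using 1
      simp
      ring
    · convert h2 k l using 1
      simp
      ring

/-! ### Real translation as a limit of powers of `1 + (h/n) d/dz`. -/

/-- The value of `(1 + c d/dz) ^ n f`, expanded by the binomial theorem. -/
noncomputable def binomialDeriv (f : ℂ → ℂ) (c : ℝ) (n : ℕ) (w : ℂ) : ℂ :=
  ∑ m ∈ Finset.range (n + 1), (n.choose m : ℂ) * ((c : ℂ) ^ m * iteratedDeriv m f w)

theorem hasDerivAt_iteratedDeriv {f : ℂ → ℂ} {w : ℂ} (hf : AnalyticAt ℂ f w) (m : ℕ) :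
    HasDerivAt (iteratedDeriv m f) (iteratedDeriv (m + 1) f w) w := by
  rw [iteratedDeriv_succ, iteratedDeriv_eq_iterate]
  exact (hf.iterated_deriv m).differentiableAt.hasDerivAt

theorem hasDerivAt_binomialDeriv {f : ℂ → ℂ} {w : ℂ} (hf : AnalyticAt ℂ f w) (c : ℝ) (n : ℕ) :
    HasDerivAt (binomialDeriv f c n)
      (∑ m ∈ Finset.range (n + 1), (n.choose m : ℂ) * ((c : ℂ) ^ m * iteratedDeriv (m + 1) f w))
      w :=
  HasDerivAt.fun_sum fun m _ => ((hasDerivAt_iteratedDeriv hf m).const_mul _).const_mul _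

theorem binomialDeriv_succ {f : ℂ → ℂ} {w : ℂ} (hf : AnalyticAt ℂ f w) (c : ℝ) (n : ℕ) :
    binomialDeriv f c (n + 1) w =
      binomialDeriv f c n w + c * deriv (binomialDeriv f c n) w := by
  rw [(hasDerivAt_binomialDeriv hf c n).deriv, binomialDeriv, binomialDeriv,
    Finset.sum_choose_succ_mul fun m _ => (c : ℂ) ^ m * iteratedDeriv m f w, Finset.mul_sum]
  congr 1
  refine Finset.sum_congr rfl fun m _ => ?_
  ring

theorem binomialDeriv_add_two {f : ℂ → ℂ} {T : Set ℂ} (hT : IsOpen T)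
    (hf : DifferentiableOn ℂ f T) (c : ℝ) (n : ℕ) {w : ℂ} (hw : w ∈ T) :
    binomialDeriv f c (n + 2) w = binomialDeriv f c n w +
      2 * c * deriv (binomialDeriv f c n) w + c ^ 2 * deriv (deriv (binomialDeriv f c n)) w := by
  have hA : ∀ v ∈ T, AnalyticAt ℂ f v := fun v hv => hf.analyticAt (hT.mem_nhds hv)
  have hd : DifferentiableOn ℂ (binomialDeriv f c n) T := fun v hv =>
    (hasDerivAt_binomialDeriv (hA v hv) c n).differentiableAt.differentiableWithinAt
  have ha : AnalyticAt ℂ (binomialDeriv f c n) w := hd.analyticAt (hT.mem_nhds hw)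
  have heq : binomialDeriv f c (n + 1) =ᶠ[𝓝 w]
      fun v => binomialDeriv f c n v + c * deriv (binomialDeriv f c n) v := by
    filter_upwards [hT.mem_nhds hw] with v hv using binomialDeriv_succ (hA v hv) c n
  have hder : HasDerivAt (fun v => binomialDeriv f c n v + c * deriv (binomialDeriv f c n) v)
      (deriv (binomialDeriv f c n) w + c * deriv (deriv (binomialDeriv f c n)) w) w :=
    ha.differentiableAt.hasDerivAt.add (ha.deriv.differentiableAt.hasDerivAt.const_mul _)
  rw [binomialDeriv_succ (hA w hw), heq.deriv_eq, hder.deriv, binomialDeriv_succ (hA w hw)]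
  ring

theorem IsCoPositiveDefiniteOn.binomialDeriv_two_mul {f : ℂ → ℂ} {T : Set ℂ}
    (h : IsCoPositiveDefiniteOn f T) (hT : IsOpen T) (hf : DifferentiableOn ℂ f T) (c : ℝ)
    (n : ℕ) : IsCoPositiveDefiniteOn (binomialDeriv f c (2 * n)) T := by
  induction n with
  | zero => exact h.congr fun w _ => by simp [binomialDeriv]
  | succ n ih =>
    have hd : DifferentiableOn ℂ (binomialDeriv f c (2 * n)) T := fun v hv =>
      (hasDerivAt_binomialDeriv (hf.analyticAt (hT.mem_nhds hv)) c _).differentiableAt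
        |>.differentiableWithinAt
    exact (ih.add_deriv_add_deriv_deriv hT hd c).congr fun w hw =>
      (binomialDeriv_add_two hT hf c (2 * n) hw).symm

/-- `(1 + (h / n) d/dz) ^ n f` converges to the translate of `f` by `h`. -/
theorem tendsto_binomialDeriv {f : ℂ → ℂ} {w : ℂ} {r h : ℝ}
    (hf : DifferentiableOn ℂ f (Metric.ball w r)) (hh : |h| < r) :
    Tendsto (fun n : ℕ => binomialDeriv f (h / n) n w) atTop (𝓝 (f (w + h))) := by
  have hsum := Complex.hasSum_taylorSeries_on_ball hf (z := w + h) (by simpa using hh)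
  simp only [add_sub_cancel_left, smul_eq_mul] at hsum
  rw [← hsum.tsum_eq]
  have htsum : ∀ n : ℕ, binomialDeriv f (h / n) n w =
      ∑' m, (n.choose m : ℂ) * (((h / n : ℝ) : ℂ) ^ m * iteratedDeriv m f w) := fun n =>
    (tsum_eq_sum fun m hm => by
      rw [Nat.choose_eq_zero_of_lt (by simpa using hm), Nat.cast_zero, zero_mul]).symm
  -- The `m`-th term tends to the Taylor term `h^m f⁽ᵐ⁾(w)/m!` and is dominated by its norm, which
  -- is summable because `|h| < r`.
  simp only [htsum]
  refine tendsto_tsum_of_dominated_convergence hsum.summable.norm (fun m => ?_)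
    (Eventually.of_forall fun n m => ?_)
  · have hp : Tendsto (fun n : ℕ => n * (h / n)) atTop (𝓝 h) := by
      refine tendsto_const_nhds.congr' ?_
      filter_upwards [eventually_ne_atTop 0] with n hn
      field_simp
    have h1 := (Complex.continuous_ofReal.tendsto _).comp
      (ProbabilityTheory.tendsto_choose_mul_pow_atTop m hp)
    convert h1.mul_const (iteratedDeriv m f w) using 2 with n
    · simp [mul_assoc]
    · push_cast
      ring
  · rw [← mul_assoc, ← mul_assoc, norm_mul, norm_mul _ (iteratedDeriv m f w)]
    refine mul_le_mul_of_nonneg_right ?_ (norm_nonneg _)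
    simp only [norm_mul, norm_pow, norm_inv, Complex.norm_real, norm_div,
      RCLike.norm_natCast]
    calc (n.choose m : ℝ) * (‖h‖ / n) ^ m
        ≤ (n : ℝ) ^ m / m.factorial * (‖h‖ / n) ^ m := by
          gcongr
          exact Nat.choose_le_pow_div m n
      _ = (m.factorial : ℝ)⁻¹ * (n * (‖h‖ / n)) ^ m := by
          rw [mul_pow]
          ring
      _ ≤ (m.factorial : ℝ)⁻¹ * ‖h‖ ^ m := by
          gcongr
          rcases eq_or_ne n 0 with rfl | hn
          · simp
          · exact (mul_div_cancel₀ _ (by exact_mod_cast hn)).le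

/-- Co-positive definiteness is inherited by real translates within discs of holomorphy. -/
theorem IsCoPositiveDefiniteOn.comp_add_real {f : ℂ → ℂ} {T : Set ℂ}
    (hpd : IsCoPositiveDefiniteOn f T) (hT : IsOpen T) {h : ℝ}
    (hf : ∀ w ∈ T, ∃ r, |h| < r ∧ DifferentiableOn ℂ f (Metric.ball w r)) :
    IsCoPositiveDefiniteOn (fun w => f (w + h)) T := by
  have hd : DifferentiableOn ℂ f T := fun w hw => by
    obtain ⟨r, hr, hfr⟩ := hf w hw
    exact (hfr.differentiableAt (Metric.ball_mem_nhds _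
      ((abs_nonneg h).trans_lt hr))).differentiableWithinAt
  intro n z hz ξ
  -- Only even powers are known to preserve definiteness, hence the subsequence `2 * N`.
  have hlim : ∀ k l, Tendsto (fun N : ℕ =>
      binomialDeriv f (h / (2 * N : ℕ)) (2 * N) (z k + conj (z l)) * ξ k * conj (ξ l)) atTop
      (𝓝 (f (z k + conj (z l) + h) * ξ k * conj (ξ l))) := by
    intro k l
    obtain ⟨r, hr, hfr⟩ := hf _ (hz k l)
    exact (((tendsto_binomialDeriv hfr hr).comp
      (tendsto_id.const_mul_atTop' two_pos)).mul_const _).mul_const _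
  exact ge_of_tendsto' (tendsto_finsetSum _ fun k _ => tendsto_finsetSum _ fun l _ => hlim k l)
    fun N => hpd.binomialDeriv_two_mul hT hd _ N n z hz ξ

/-! ### Propagation along the negative real axis. -/

/-- The function `f` is co-positive definite in some open set of the left half-plane around `x`. -/
def IsCoPositiveDefiniteNear (f : ℂ → ℂ) (x : ℝ) : Prop :=
  ∃ T : Set ℂ, IsOpen T ∧ (x : ℂ) ∈ T ∧ T ⊆ {z | z.re < 0} ∧ IsCoPositiveDefiniteOn f T

theorem IsCoPositiveDefiniteNear.of_mem_Ioo {f : ℂ → ℂ}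
    (hf : DifferentiableOn ℂ f {z | z.re < 0}) {x y : ℝ}
    (h : IsCoPositiveDefiniteNear f x) (hy : y ∈ Ioo (2 * x) 0) :
    IsCoPositiveDefiniteNear f y := by
  obtain ⟨T, hT, hxT, hTneg, hpd⟩ := h
  have hlt : |y - x| < -x := abs_lt.mpr ⟨by linarith [hy.1], by linarith [hy.2]⟩
  -- The radius forces `w.re < -|y - x|` on `S`, so the disc about `w` of radius `-w.re` lies in the
  -- left half-plane and admits the shift by `y - x`.
  set S : Set ℂ := T ∩ Metric.ball (x : ℂ) (-x - |y - x|) with hS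
  have hSopen : IsOpen S := hT.inter Metric.isOpen_ball
  have hre : ∀ w ∈ S, |y - x| < -w.re := by
    intro w hw
    have h1 := (Complex.abs_re_le_norm (w - x)).trans_lt (by simpa [dist_eq_norm] using hw.2)
    have h2 := (abs_lt.mp h1).2
    simp only [Complex.sub_re, Complex.ofReal_re] at h2
    linarith
  have hSpd : IsCoPositiveDefiniteOn f S := fun n z hz => hpd n z fun k l => (hz k l).1
  have hshift := hSpd.comp_add_real hSopen (h := y - x) fun w hw =>
    ⟨-w.re, hre w hw, hf.mono fun v hv => by
      have h1 := (Complex.abs_re_le_norm (v - w)).trans_lt (by simpa [dist_eq_norm] using hv)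
      have h2 := (abs_lt.mp h1).2
      simp only [Complex.sub_re] at h2
      change v.re < 0
      linarith⟩
  refine ⟨(fun w => w - ((y - x : ℝ) : ℂ)) ⁻¹' S,
    hSopen.preimage (continuous_id.sub continuous_const), ?_, fun w hw => ?_, ?_⟩
  · simp only [mem_preimage, Complex.ofReal_sub, sub_sub_cancel]
    exact ⟨hxT, Metric.mem_ball_self (by linarith)⟩
  · have h1 := hre _ hw
    simp only [Complex.sub_re, Complex.ofReal_re] at h1
    change w.re < 0
    linarith [le_abs_self (y - x)]
  · intro n z hz ξ
    -- Moving every point by half of a real shift moves each sum `z k + conj (z l)` by the whole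
    -- shift.
    have hhalf : ∀ k l, z k - ((y - x : ℝ) : ℂ) / 2 + conj (z l - ((y - x : ℝ) : ℂ) / 2) =
        z k + conj (z l) - ((y - x : ℝ) : ℂ) := by
      intro k l
      rw [map_sub, map_div₀, Complex.conj_ofReal, map_ofNat]
      ring
    have := hshift n (fun k => z k - ((y - x : ℝ) : ℂ) / 2)
      (fun k l => by rw [hhalf]; exact hz k l) ξ
    simpa only [hhalf, sub_add_cancel] using this

/-- For a function holomorphic in the left half-plane, local co-positive definiteness at one
negative point propagates along the whole negative axis. -/
theorem IsCoPositiveDefiniteNear.of_neg {f : ℂ → ℂ}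
    (hf : DifferentiableOn ℂ f {z | z.re < 0}) {x y : ℝ} (hx : x < 0)
    (h : IsCoPositiveDefiniteNear f x) (hy : y < 0) : IsCoPositiveDefiniteNear f y := by
  -- One translation from `x` reaches all of `(2x, 0)`; iterating doubles the range each time.
  have key : ∀ n : ℕ, ∀ y ∈ Ioo (2 ^ (n + 1) * x) 0, IsCoPositiveDefiniteNear f y := by
    intro n
    induction n with
    | zero => exact fun y hy => h.of_mem_Ioo hf (by simpa using hy)
    | succ n ih =>
      intro y hy
      have h1 : 2 ^ (n + 1) * x < y / 2 := by
        have := hy.1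
        rw [pow_succ] at this
        linarith
      obtain ⟨u, hu1, hu2⟩ := exists_between h1
      exact (ih u ⟨hu1, by linarith [hy.2]⟩).of_mem_Ioo hf ⟨by linarith, hy.2⟩
  obtain ⟨n, hn⟩ := pow_unbounded_of_one_lt (y / x) (one_lt_two (α := ℝ))
  refine key n y ⟨?_, hy⟩
  have h1 : 2 ^ n * x < y := (div_lt_iff_of_neg hx).mp hn
  have h2 : (0 : ℝ) < 2 ^ n := by positivity
  rw [pow_succ]
  nlinarith

theorem IsCoPositiveDefiniteOn.nonneg_of_neg {f : ℂ → ℂ}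
    (hf : DifferentiableOn ℂ f {z | z.re < 0}) {T : Set ℂ} (hcosum : IsCosumSet T)
    (hT : IsOpen T) (hne : T.Nonempty) (hneg : T ⊆ {z | z.re < 0})
    (hpd : IsCoPositiveDefiniteOn f T) {y : ℝ} (hy : y < 0) : 0 ≤ f y := by
  obtain ⟨Ω, rfl⟩ := hcosum
  obtain ⟨_, z, hz, -⟩ := hne
  -- The cosum hypothesis provides a real point, `z + conj z`, from which to start.
  have hx : ((2 * z.re : ℝ) : ℂ) ∈ cosum Ω := ⟨z, hz, z, hz, (Complex.add_conj z).symm⟩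
  have hx0 : 2 * z.re < 0 := by simpa only [mem_ofPred_eq, Complex.ofReal_re] using hneg hx
  obtain ⟨S, -, hyS, -, hS⟩ :=
    IsCoPositiveDefiniteNear.of_neg hf hx0 ⟨_, hT, hx, hneg, hpd⟩ hy
  exact hS.nonneg_of_mem hyS

/-! ### Holomorphy, two special values, and the conclusion. -/

theorem differentiableOn_zedFunction {T : Set ℂ} (h0 : (0 : ℂ) ∉ T) (h1 : (1 : ℂ) ∉ T) :
    DifferentiableOn ℂ zedFunction T := fun _ hz =>
  ((differentiableAt_riemannZeta (ne_of_mem_of_not_mem hz h1)).neg.div differentiableAt_id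
    (ne_of_mem_of_not_mem hz h0)).differentiableWithinAt

theorem zedFunction_neg_one : zedFunction ((-1 : ℝ) : ℂ) = ((-1 / 12 : ℝ) : ℂ) := by
  have h := riemannZeta_neg_nat_eq_bernoulli' 1
  norm_num at h
  rw [zedFunction, Complex.ofReal_neg, Complex.ofReal_one, h]
  norm_num

theorem zedFunction_neg_three : zedFunction ((-3 : ℝ) : ℂ) = ((1 / 360 : ℝ) : ℂ) := by
  have h := riemannZeta_neg_nat_eq_bernoulli' 3
  norm_num at h
  rw [zedFunction, Complex.ofReal_neg, Complex.ofReal_ofNat, h]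
  norm_num

theorem mainTheorem8 :
    (DifferentiableOn ℂ zedFunction (verticalStrip 0 1) ∧
      IsCoPositiveDefiniteOn zedFunction (verticalStrip 0 1) ∧
      HasDensityOn zedFunction (fun t => Int.fract (Real.exp t)) (verticalStrip 0 1) ∧
      IsExponentiallyFinite (densityMeasure (fun t => Int.fract (Real.exp t))) (Set.Ioo 0 1) ∧
      (∀ t : ℝ, Int.fract (Real.exp t) = Real.exp t - (logCount t : ℝ))) ∧
    (DifferentiableOn ℂ zedFunction (verticalStrip 1 ⊤) ∧
      IsCoNegativeDefiniteOn zedFunction (verticalStrip 1 ⊤) ∧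
      HasDensityOn zedFunction (fun t => -(logCount t : ℝ)) (verticalStrip 1 ⊤) ∧
      IsExponentiallyFinite (densityMeasure (fun t => (logCount t : ℝ))) (Set.Ioi 1)) ∧
    (∀ T : Set ℂ, IsCosumSet T → IsOpen T → T.Nonempty → T ⊆ verticalStrip ⊥ 0 →
      ¬ IsCoPositiveDefiniteOn zedFunction T ∧ ¬ IsCoNegativeDefiniteOn zedFunction T) := by
  have hlog : Measurable fun t : ℝ => (logCount t : ℝ) := by
    simp only [logCount_eq_floor]
    fun_prop
  refine ⟨⟨differentiableOn_zedFunction (by simp [verticalStrip]) (by simp [verticalStrip]),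
    hasDensityOn_fract.isCoPositiveDefiniteOn fun t => Int.fract_nonneg _, hasDensityOn_fract,
    hasDensityOn_fract.isExponentiallyFinite (fun t => Int.fract_nonneg _) (by fun_prop) ?_,
    fract_exp_eq_sub_logCount⟩,
    ⟨differentiableOn_zedFunction (by simp [verticalStrip]) (by simp [verticalStrip]),
    hasDensityOn_logCount.isCoPositiveDefiniteOn fun t => Nat.cast_nonneg _,
    by simpa only [neg_neg] using hasDensityOn_logCount.neg,
    hasDensityOn_logCount.isExponentiallyFinite (fun t => Nat.cast_nonneg _) hlog ?_⟩, ?_⟩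
  · rintro y ⟨h0, h1⟩
    exact ⟨by exact_mod_cast h0, by exact_mod_cast h1⟩
  · intro y hy
    exact ⟨by exact_mod_cast mem_Ioi.mp hy, EReal.coe_lt_top _⟩
  · intro T hcosum hT hne hsub
    have hneg : T ⊆ {z : ℂ | z.re < 0} := fun z hz => by exact_mod_cast (hsub hz).2
    have hd : DifferentiableOn ℂ zedFunction {z | z.re < 0} :=
      differentiableOn_zedFunction (by simp) (by norm_num)
    constructor
    · intro hpd
      have h := hpd.nonneg_of_neg hd hcosum hT hne hneg (y := -1) (by norm_num)
      rw [zedFunction_neg_one] at h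
      rw [Complex.zero_le_real] at h
      norm_num at h
    · intro hpd
      have h := IsCoPositiveDefiniteOn.nonneg_of_neg hd.neg hcosum hT hne hneg hpd (y := -3)
        (by norm_num)
      rw [Pi.neg_apply, zedFunction_neg_three, ← Complex.ofReal_neg, Complex.zero_le_real] at h
      norm_num at h
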